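/- Let $L, C, R$ be finite-dimensional quantum systems, with $L,R$ non-zero, and write $\mathcal M_S$ for the full matrix algebra of a system $S$ and $\mathrm{Ad}_U(x)=UxU^{\dagger}$. Let the unitary $U\in\mathcal M_{LCR}$ be a left-wall, i.e. $\mathrm{Ad}_U^t(\mathcal M_L\otimes 1_{CR})\subseteq \mathcal M_{LC}\otimes 1_R$ for all $t\ge 0$. Let $\overline{\mathcal M_L}$ be the algebra generated by $\mathrm{Ad}_U^t(\mathcal M_L\otimes 1_{CR})$, $t\ge 0$, and let $\mathcal A_C\subseteq\mathcal M_C$ be the algebra with $\overline{\mathcal M_L}=\mathcal M_L\otimes\mathcal A_C\otimes 1_R$. Let $\mathcal H_C\cong\bigoplus_i \mathcal D_i\otimes\mathcal E_i$ be a (unitary) decomposition into the irreducible blocks of $\mathcal A_C$, so that $\mathcal A_C\cong\bigoplus_i \mathcal M_{\mathcal D_i}\otimes 1_{\mathcal E_i}$, and suppose that in it $$U=\bigoplus_i T^i_{L\mathcal D_i}\otimes R^i_{\mathcal E_i R}$$ with unitaries $T^i$ and $R^i$. Then the set of operators contained in $C$ that commute with $U$, $$\mathcal Q_C=\{Q\in\mathcal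 M_C : [1_L\otimes Q\otimes 1_R,\,U]=0\},$$ is, under the same identification of $\mathcal H_C$, $$\mathcal Q_C=\bigoplus_i \mathrm{Comm}(\mathcal T_{\mathcal D_i})\otimes\mathrm{Comm}(\mathcal R_{\mathcal E_i}).$$ Here $\mathcal T_{\mathcal D_i}\subseteq\mathcal M_{\mathcal D_i}$ is the $C^*$-algebra generated by the operator-Schmidt vectors of $T^i_{L\mathcal D_i}$ on $\mathcal D_i$, $\mathcal R_{\mathcal E_i}\subseteq\mathcal M_{\mathcal E_i}$ is the $C^*$-algebra generated by the operator-Schmidt vectors of $R^i_{\mathcal E_i R}$ on $\mathcal E_i$, and the commutants are taken in $\mathcal M_{\mathcal D_i}$ and $\mathcal M_{\mathcal E_i}$. The operator-Schmidt vectors of $X$ on $P\otimes Q$ are the operators $A_k$ on $P$ and $B_k$ on $Q$ occurring in a decomposition $X=\sum_k s_k A_k\otimes B_k$ with $s_k>0$ and with $(A_k)$, $(B_k)$ orthonormal for the Hilbert-Schmidt inner product. -/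

import Mathlib

open scoped Kronecker Matrix

namespace QuantumWall

noncomputable section

section Tripartite

variable {L C R : Type*} [Fintype L] [DecidableEq L] [Fintype C] [DecidableEq C]
  [Fintype R] [DecidableEq R]

/-- The operator `m_L ⊗ 1_{CR}` on the tripartite system. -/
def onL (C R : Type*) [DecidableEq C] [DecidableEq R] (m : Matrix L L ℂ) :
    Matrix (L × C × R) (L × C × R) ℂ :=
  m ⊗ₖ (1 : Matrix (C × R) (C × R) ℂ)

/-- The operator `1_L ⊗ Q_C ⊗ 1_R` on the tripartite system. -/
def onC (L R : Type*) [DecidableEq L] [DecidableEq R] (Q : Matrix C C ℂ) :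
    Matrix (L × C × R) (L × C × R) ℂ :=
  (1 : Matrix L L ℂ) ⊗ₖ (Q ⊗ₖ (1 : Matrix R R ℂ))

/-- The operator `m_{LC} ⊗ 1_R` on the tripartite system. -/
def onLC (R : Type*) [DecidableEq R] (m : Matrix (L × C) (L × C) ℂ) :
    Matrix (L × C × R) (L × C × R) ℂ :=
  (m ⊗ₖ (1 : Matrix R R ℂ)).submatrix (Equiv.prodAssoc L C R).symm (Equiv.prodAssoc L C R).symm

/-- The evolved operator `Ad_U^t (X) = U ^ t X U ^ (-t)`, where `U` is unitary. -/
def evolve {S : Type*} [Fintype S] [DecidableEq S] (U : Matrix S S ℂ) (t : ℕ) (X : Matrix S S ℂ) :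
    Matrix S S ℂ :=
  U ^ t * X * Uᴴ ^ t

/-- `U` is a left-wall: it is unitary, and every operator in `L` stays in `LC` at all times. -/
def IsLeftWall (U : Matrix (L × C × R) (L × C × R) ℂ) : Prop :=
  U ∈ Matrix.unitaryGroup (L × C × R) ℂ ∧
    ∀ (t : ℕ) (m : Matrix L L ℂ), ∃ m' : Matrix (L × C) (L × C) ℂ,
      evolve U t (onL C R m) = onLC R m'

/-- The algebra generated by all operators `Ad_U^t (m_L ⊗ 1_{CR})`, `t ≥ 0`. -/
def leftAlgebra (U : Matrix (L × C × R) (L × C × R) ℂ) :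
    StarSubalgebra ℂ (Matrix (L × C × R) (L × C × R) ℂ) :=
  StarAlgebra.adjoin ℂ {X | ∃ (t : ℕ) (m : Matrix L L ℂ), X = evolve U t (onL C R m)}

/-- The algebra `A_C` embedded in `C` by `U`: the operators `a` on `C` such that
`1_L ⊗ a ⊗ 1_R` lies in the algebra generated by the evolved `L`-local operators. For a left-wall
it is the algebra with `leftAlgebra U = M_L ⊗ A_C ⊗ 1_R`, see `leftAlgebra_eq_span`. -/
def embeddedAlgebra (U : Matrix (L × C × R) (L × C × R) ℂ) : Set (Matrix C C ℂ) :=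
  {a | onC L R a ∈ leftAlgebra U}

theorem exists_onLC_of_mem {U : Matrix (L × C × R) (L × C × R) ℂ} (hU : IsLeftWall U)
    {X : Matrix (L × C × R) (L × C × R) ℂ} (hX : X ∈ leftAlgebra U) :
    ∃ m : Matrix (L × C) (L × C) ℂ, X = onLC R m := by
  induction hX using StarAlgebra.adjoin_induction with
  | mem x hx =>
    obtain ⟨t, m, rfl⟩ := hx
    exact hU.2 t m
  | algebraMap r =>
    refine ⟨r • 1, ?_⟩
    rw [onLC, Matrix.smul_kronecker, Matrix.one_kronecker_one, Matrix.submatrix_smul]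
    simp [Algebra.algebraMap_eq_smul_one]
  | add x y _ _ hx hy =>
    obtain ⟨a, rfl⟩ := hx
    obtain ⟨b, rfl⟩ := hy
    exact ⟨a + b, by simp [onLC, Matrix.add_kronecker, Matrix.submatrix_add]⟩
  | mul x y _ _ hx hy =>
    obtain ⟨a, rfl⟩ := hx
    obtain ⟨b, rfl⟩ := hy
    refine ⟨a * b, ?_⟩
    rw [onLC, onLC, onLC, Matrix.submatrix_mul_equiv, ← Matrix.mul_kronecker_mul, one_mul]
  | star x _ hx =>
    obtain ⟨a, rfl⟩ := hx
    refine ⟨aᴴ, ?_⟩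
    rw [onLC, onLC, Matrix.star_eq_conjTranspose, Matrix.conjTranspose_submatrix,
      Matrix.conjTranspose_kronecker, Matrix.conjTranspose_one]

theorem onL_mem_leftAlgebra (U : Matrix (L × C × R) (L × C × R) ℂ) (m : Matrix L L ℂ) :
    onL C R m ∈ leftAlgebra U :=
  StarAlgebra.subset_adjoin ℂ _ ⟨0, m, by simp [evolve]⟩

/-- For a left-wall, the algebra generated by the evolved `L`-local operators is
`M_L ⊗ A_C ⊗ 1_R`. -/
theorem leftAlgebra_eq_span {U : Matrix (L × C × R) (L × C × R) ℂ} (hU : IsLeftWall U) :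
    (leftAlgebra U : Set (Matrix (L × C × R) (L × C × R) ℂ)) =
      Submodule.span ℂ {X | ∃ m : Matrix L L ℂ, ∃ a ∈ embeddedAlgebra U,
        X = m ⊗ₖ (a ⊗ₖ (1 : Matrix R R ℂ))} := by
  apply Set.Subset.antisymm
  · intro X hX
    obtain ⟨M, hM⟩ := exists_onLC_of_mem hU hX
    have hentry : ∀ i c r j c' r', X (i, c, r) (j, c', r') =
        M (i, c) (j, c') * (1 : Matrix R R ℂ) r r' := by
      intro i c r j c' r'
      rw [hM]
      rfl
    have hsub : ∀ i j, (Matrix.of fun c c' => M (i, c) (j, c')) ∈ embeddedAlgebra U := by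
      intro i j
      have : onC L R (Matrix.of fun c c' => M (i, c) (j, c')) =
          ∑ k, onL C R (Matrix.single k i 1) * X * onL C R (Matrix.single j k 1) := by
        ext ⟨l, c, r⟩ ⟨l', c', r'⟩
        simp [Matrix.sum_apply, Matrix.mul_apply, Fintype.sum_prod_type, onL, onC, hentry,
          Matrix.kroneckerMap_apply, Matrix.single_apply, Matrix.one_apply, Prod.ext_iff,
          ite_and, Finset.sum_ite_eq, eq_comm]
      rw [embeddedAlgebra, Set.mem_ofPred_eq, this]
      exact sum_mem fun k _ => mul_mem (mul_mem (onL_mem_leftAlgebra U _) hX)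
        (onL_mem_leftAlgebra U _)
    have hsum : X = ∑ i, ∑ j, (Matrix.single i j (1 : ℂ)) ⊗ₖ
        ((Matrix.of fun c c' => M (i, c) (j, c')) ⊗ₖ (1 : Matrix R R ℂ)) := by
      ext ⟨l, c, r⟩ ⟨l', c', r'⟩
      simp [Matrix.sum_apply, hentry, Matrix.kroneckerMap_apply, Matrix.single_apply, ite_and]
    rw [hsum]
    exact sum_mem fun i _ => sum_mem fun j _ => Submodule.subset_span ⟨_, _, hsub i j, rfl⟩
  · intro X hX
    have hle : Submodule.span ℂ {X | ∃ m : Matrix L L ℂ, ∃ a ∈ embeddedAlgebra U,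
        X = m ⊗ₖ (a ⊗ₖ (1 : Matrix R R ℂ))} ≤ (leftAlgebra U).toSubalgebra.toSubmodule := by
      rw [Submodule.span_le]
      rintro _ ⟨m, a, ha, rfl⟩
      have : m ⊗ₖ (a ⊗ₖ (1 : Matrix R R ℂ)) = onL C R m * onC L R a := by
        rw [onL, onC, ← Matrix.mul_kronecker_mul, mul_one, one_mul]
      rw [this]
      exact (leftAlgebra U).mul_mem (onL_mem_leftAlgebra U m) ha
    exact hle hX

/-- The set of operators contained in `C` that commute with `U`. -/
def localCommutant (U : Matrix (L × C × R) (L × C × R) ℂ) : Set (Matrix C C ℂ) :=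
  {Q | Commute (onC L R Q) U}

end Tripartite

section Schmidt

variable {P Q : Type*} [Fintype P] [Fintype Q]

/-- `X = ∑ₖ sₖ Aₖ ⊗ Bₖ` is an operator-Schmidt decomposition of `X`: the coefficients `sₖ` are
positive and the families `Aₖ`, `Bₖ` are orthonormal for the Hilbert-Schmidt inner product. -/
structure IsOperatorSchmidt {n : ℕ} (X : Matrix (P × Q) (P × Q) ℂ) (s : Fin n → ℝ)
    (A : Fin n → Matrix P P ℂ) (B : Fin n → Matrix Q Q ℂ) : Prop where
  pos : ∀ k, 0 < s k
  orthonormal_left : ∀ j k, ((A j)ᴴ * A k).trace = if j = k then 1 else 0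
  orthonormal_right : ∀ j k, ((B j)ᴴ * B k).trace = if j = k then 1 else 0
  eq_sum : X = ∑ k, (s k : ℂ) • (A k ⊗ₖ B k)

/-- The operator-Schmidt vectors of `X_{PQ}` on the first factor `P`. -/
def schmidtLeft (X : Matrix (P × Q) (P × Q) ℂ) : Set (Matrix P P ℂ) :=
  {a | ∃ (n : ℕ) (s : Fin n → ℝ) (A : Fin n → Matrix P P ℂ) (B : Fin n → Matrix Q Q ℂ),
    IsOperatorSchmidt X s A B ∧ ∃ k, a = A k}

/-- The operator-Schmidt vectors of `X_{PQ}` on the second factor `Q`. -/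
def schmidtRight (X : Matrix (P × Q) (P × Q) ℂ) : Set (Matrix Q Q ℂ) :=
  {b | ∃ (n : ℕ) (s : Fin n → ℝ) (A : Fin n → Matrix P P ℂ) (B : Fin n → Matrix Q Q ℂ),
    IsOperatorSchmidt X s A B ∧ ∃ k, b = B k}

/-- The commutant of an algebra of operators. -/
def Comm {S : Type*} [Fintype S] [DecidableEq S] (A : StarSubalgebra ℂ (Matrix S S ℂ)) :
    Set (Matrix S S ℂ) :=
  {c | ∀ a ∈ A, Commute c a}

/-- The tensor product of two spaces of operators, as a space of operators on `P ⊗ Q`. -/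
def tensorSpan (V : Set (Matrix P P ℂ)) (W : Set (Matrix Q Q ℂ)) :
    Submodule ℂ (Matrix (P × Q) (P × Q) ℂ) :=
  Submodule.span ℂ {X | ∃ a ∈ V, ∃ b ∈ W, X = a ⊗ₖ b}

end Schmidt

section Blocks

variable {L C R ι : Type*} {D E : ι → Type*} [DecidableEq L] [DecidableEq R] [DecidableEq ι]

/-- The index bijection realising
`L ⊗ (⨁ᵢ Dᵢ ⊗ Eᵢ) ⊗ R = ⨁ᵢ (L ⊗ Dᵢ) ⊗ (Eᵢ ⊗ R)`. -/
def blockIndex (L R : Type*) {ι : Type*} (D E : ι → Type*) :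
    L × (Σ i, D i × E i) × R ≃ Σ i, (L × D i) × (E i × R) where
  toFun x := ⟨x.2.1.1, (x.1, x.2.1.2.1), (x.2.1.2.2, x.2.2)⟩
  invFun y := (y.2.1.1, ⟨y.1, (y.2.1.2, y.2.2.1)⟩, y.2.2.2)
  left_inv _ := rfl
  right_inv _ := rfl

/-- The operator `⨁ᵢ Tⁱ_{L Dᵢ} ⊗ Rⁱ_{Eᵢ R}` on `L ⊗ (⨁ᵢ Dᵢ ⊗ Eᵢ) ⊗ R`. -/
def wallSum (T : ∀ i, Matrix (L × D i) (L × D i) ℂ) (S : ∀ i, Matrix (E i × R) (E i × R) ℂ) :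
    Matrix (L × (Σ i, D i × E i) × R) (L × (Σ i, D i × E i) × R) ℂ :=
  (Matrix.blockDiagonal' fun i => T i ⊗ₖ S i).submatrix (blockIndex L R D E) (blockIndex L R D E)

/-- The unitary identification `1_L ⊗ W ⊗ 1_R` of `L ⊗ (⨁ᵢ Dᵢ ⊗ Eᵢ) ⊗ R` with `L ⊗ C ⊗ R` induced
by an identification `W` of `⨁ᵢ Dᵢ ⊗ Eᵢ` with `C`. -/
def extendIso (L R : Type*) [DecidableEq L] [DecidableEq R] (W : Matrix C (Σ i, D i × E i) ℂ) :
    Matrix (L × C × R) (L × (Σ i, D i × E i) × R) ℂ :=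
  (1 : Matrix L L ℂ) ⊗ₖ (W ⊗ₖ (1 : Matrix R R ℂ))

/-- The algebra `⨁ᵢ M_{Dᵢ} ⊗ 1_{Eᵢ}`, as operators on `C` through the identification `W`. -/
def factorBlocks [Fintype ι] [∀ i, Fintype (D i)] [∀ i, Fintype (E i)] [∀ i, DecidableEq (E i)]
    (W : Matrix C (Σ i, D i × E i) ℂ) : Set (Matrix C C ℂ) :=
  {a | ∃ m : ∀ i, Matrix (D i) (D i) ℂ,
    a = W * (Matrix.blockDiagonal' fun i => m i ⊗ₖ (1 : Matrix (E i) (E i) ℂ)) * Wᴴ}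

/-- The direct sum `⨁ᵢ Vᵢ` of spaces of operators `Vᵢ` on `Dᵢ ⊗ Eᵢ`, as operators on `C` through
the identification `W`. -/
def directSumBlocks [Fintype ι] [∀ i, Fintype (D i)] [∀ i, Fintype (E i)]
    (W : Matrix C (Σ i, D i × E i) ℂ)
    (V : ∀ i, Submodule ℂ (Matrix (D i × E i) (D i × E i) ℂ)) : Set (Matrix C C ℂ) :=
  {Q | ∃ Y : ∀ i, Matrix (D i × E i) (D i × E i) ℂ,
    (∀ i, Y i ∈ V i) ∧ Q = W * Matrix.blockDiagonal' Y * Wᴴ}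

end Blocks

end

end QuantumWall

/-!
The operators `Q` on `C` commuting with a left-wall `U` are computed block by block.

If `1 ⊗ Q ⊗ 1` commutes with `U`, then, as it also commutes with `M_L`, it commutes with every
evolved operator `Ad_U^t (m_L ⊗ 1)` and so with the algebra they generate; hence `Q` commutes with
`A_C = ⨁ᵢ M_{Dᵢ} ⊗ 1_{Eᵢ}` (`commute_embeddedAlgebra`). The commutant of that algebra is
`⨁ᵢ 1_{Dᵢ} ⊗ M_{Eᵢ}` (`exists_eq_blockDiagonal'_one_kronecker`), so `Q = ⨁ᵢ 1 ⊗ qᵢ`, and commuting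
with `U` says that `1 ⊗ (qᵢ ⊗ 1_R)` commutes with `Tⁱ ⊗ Sⁱ` for each `i`. The invertible factor `Tⁱ`
cancels, and `qᵢ ⊗ 1_R` commutes with `Sⁱ`. Contracting an operator-Schmidt decomposition of `Sⁱ`
with its orthonormal right vectors shows that `qᵢ` commutes with the left vectors
(`mem_Comm_schmidtLeft`); since `Sⁱ` is unitary, it commutes with their adjoints as well.

Conversely, `Tⁱ` and `Sⁱ` have operator-Schmidt decompositions (`exists_isOperatorSchmidt`, a
singular value decomposition of the realigned matrix). An operator commuting with the Schmidt
vectors on one factor commutes, after tensoring with the identity, with the operator itself.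
-/

namespace QuantumWall

/-! ### Commutants of adjoints and of generated star algebras -/

section Star

variable {A : Type*} [Ring A] [StarRing A]

theorem commute_star_of_mem_unitary {z u : A} (hu : u ∈ unitary A) (h : Commute z u) :
    Commute (star z) u := by
  have h1 : Commute z (star u) := h.units_inv_right (u := Unitary.toUnits ⟨u, hu⟩)
  simpa using h1.star_star

theorem commute_of_mem_starAdjoin [Algebra ℂ A] [StarModule ℂ A] {s : Set A} {z : A}
    (h : ∀ x ∈ s, Commute z x) (h' : ∀ x ∈ s, Commute (star z) x) {x : A}
    (hx : x ∈ StarAlgebra.adjoin ℂ s) : Commute z x := by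
  -- commutation with `star z` is carried along, as it is what the star of a generator needs
  suffices Commute z x ∧ Commute (star z) x from this.1
  induction hx using StarAlgebra.adjoin_induction with
  | mem x hx => exact ⟨h x hx, h' x hx⟩
  | algebraMap r =>
    exact ⟨Algebra.commute_algebraMap_right r _, Algebra.commute_algebraMap_right r _⟩
  | add x y _ _ hx hy => exact ⟨hx.1.add_right hy.1, hx.2.add_right hy.2⟩
  | mul x y _ _ hx hy => exact ⟨hx.1.mul_right hy.1, hx.2.mul_right hy.2⟩
  | star x _ hx => exact ⟨by simpa using hx.2.star_star, hx.1.star_star⟩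

end Star

/-! ### Operator-Schmidt decompositions and commutants -/

section Schmidt

open scoped ComplexOrder in
/-- A singular value decomposition without the left unitary: `M` times a suitable unitary has
pairwise orthogonal columns. -/
theorem exists_unitary_mul_orthogonal_columns {m n : Type*} [Fintype m] [Fintype n]
    [DecidableEq n] (M : Matrix m n ℂ) :
    ∃ (V : Matrix n n ℂ) (l : n → ℝ), V * Vᴴ = 1 ∧ Vᴴ * V = 1 ∧ (∀ k, 0 ≤ l k) ∧
      (M * V)ᴴ * (M * V) = Matrix.diagonal fun k => (l k : ℂ) := by
  have hp : (Mᴴ * M).PosSemidef := Matrix.posSemidef_conjTranspose_mul_self M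
  have hV := hp.isHermitian.eigenvectorUnitary.2
  set V : Matrix n n ℂ := (hp.isHermitian.eigenvectorUnitary : Matrix n n ℂ) with hVdef
  have h1 : V * Vᴴ = 1 := Matrix.mem_unitaryGroup_iff.mp hV
  have h2 : Vᴴ * V = 1 := Matrix.mem_unitaryGroup_iff'.mp hV
  refine ⟨V, hp.isHermitian.eigenvalues, h1, h2, hp.eigenvalues_nonneg, ?_⟩
  have hs := hp.isHermitian.spectral_theorem
  rw [Unitary.conjStarAlgAut_apply, ← hVdef] at hs
  change Mᴴ * M = V * _ * Vᴴ at hs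
  calc (M * V)ᴴ * (M * V) = Vᴴ * (Mᴴ * M) * V := by
        simp only [Matrix.conjTranspose_mul, Matrix.mul_assoc]
    _ = Vᴴ * (V * Matrix.diagonal (fun k => (hp.isHermitian.eigenvalues k : ℂ)) * Vᴴ) * V :=
        congrArg (fun Z => Vᴴ * Z * V) hs
    _ = _ := by
        simp only [Matrix.mul_assoc, h2, Matrix.mul_one]
        rw [← Matrix.mul_assoc, h2, Matrix.one_mul]

theorem trace_conjTranspose_mul_eq_sum {P : Type*} [Fintype P] (A B : Matrix P P ℂ) :
    (Aᴴ * B).trace = ∑ x : P × P, star (A x.1 x.2) * B x.1 x.2 := by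
  rw [Fintype.sum_prod_type_right]
  simp [Matrix.trace, Matrix.mul_apply]

variable {P Q : Type*} [Fintype P] [Fintype Q] [DecidableEq Q]

theorem exists_isOperatorSchmidt (X : Matrix (P × Q) (P × Q) ℂ) :
    ∃ (n : ℕ) (s : Fin n → ℝ) (A : Fin n → Matrix P P ℂ) (B : Fin n → Matrix Q Q ℂ),
      IsOperatorSchmidt X s A B := by
  -- the realignment of `X`, whose singular value decomposition is the Schmidt decomposition
  let M : Matrix (P × P) (Q × Q) ℂ := Matrix.of fun x y => X (x.1, y.1) (x.2, y.2)
  obtain ⟨V, l, hVV, hVV', hl, hN⟩ := exists_unitary_mul_orthogonal_columns M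
  set N := M * V with hNdef
  have hM : M = N * Vᴴ := by rw [hNdef, Matrix.mul_assoc, hVV, Matrix.mul_one]
  have hNe : ∀ j k, ∑ x, star (N x j) * N x k = if j = k then (l j : ℂ) else 0 := by
    intro j k
    have := congrFun (congrFun hN j) k
    rw [Matrix.mul_apply, Matrix.diagonal_apply] at this
    simpa using this
  have hVe : ∀ j k, ∑ y, V y j * star (V y k) = if j = k then 1 else 0 := by
    intro j k
    have := congrFun (congrFun hVV' k) j
    rw [Matrix.mul_apply, Matrix.one_apply] at this
    simpa [mul_comm, eq_comm] using this
  -- columns for the singular value zero vanish and are left out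
  have hzero : ∀ k, ¬ 0 < l k → ∀ x, N x k = 0 := by
    intro k hk x
    have hk0 : l k = 0 := le_antisymm (not_lt.mp hk) (hl k)
    have h := hNe k k
    rw [if_pos rfl, hk0] at h
    have h' : ∑ x, ‖N x k‖ ^ 2 = 0 := by
      have : ((∑ x, ‖N x k‖ ^ 2 : ℝ) : ℂ) = 0 := by
        rw [← Complex.ofReal_zero, ← h]
        push_cast
        exact Finset.sum_congr rfl fun x _ => (Complex.conj_mul' _).symm
      exact_mod_cast this
    have := (Finset.sum_eq_zero_iff_of_nonneg fun x _ => sq_nonneg _).mp h' x (Finset.mem_univ _)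
    simpa using this
  let K := {k : Q × Q // 0 < l k}
  let e : Fin (Fintype.card K) ≃ K := (Fintype.equivFin K).symm
  have hpos : ∀ k, 0 < √(l (e k).1) := fun k => Real.sqrt_pos.mpr (e k).2
  have hne : ∀ k, ((√(l (e k).1) : ℝ) : ℂ) ≠ 0 := fun k => by exact_mod_cast (hpos k).ne'
  have hinj : ∀ j k, (e j).1 = (e k).1 ↔ j = k := fun j k =>
    ⟨fun h => e.injective (Subtype.ext h), fun h => h ▸ rfl⟩
  refine ⟨Fintype.card K, fun k => √(l (e k).1),
    fun k => Matrix.of fun p p' => ((√(l (e k).1) : ℝ) : ℂ)⁻¹ * N (p, p') (e k).1,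
    fun k => Matrix.of fun q q' => star (V (q, q') (e k).1), hpos, ?_, ?_, ?_⟩
  · intro j k
    rw [trace_conjTranspose_mul_eq_sum]
    have : ∀ x : P × P, star (((√(l (e j).1) : ℝ) : ℂ)⁻¹ * N x (e j).1) *
        (((√(l (e k).1) : ℝ) : ℂ)⁻¹ * N x (e k).1) =
        (((√(l (e j).1) : ℝ) : ℂ)⁻¹ * ((√(l (e k).1) : ℝ) : ℂ)⁻¹) *
          (star (N x (e j).1) * N x (e k).1) := by
      intro x
      simp only [star_mul', star_inv₀, Complex.star_def, Complex.conj_ofReal]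
      ring
    simp only [Matrix.of_apply, this, ← Finset.mul_sum, hNe, hinj]
    split_ifs with h
    · subst h
      have h2 : (l (e j).1 : ℂ) = ((√(l (e j).1) : ℝ) : ℂ) * ((√(l (e j).1) : ℝ) : ℂ) := by
        rw [← Complex.ofReal_mul, Real.mul_self_sqrt (hl _)]
      have := hne j
      rw [h2]
      field_simp
    · rw [mul_zero]
  · intro j k
    rw [trace_conjTranspose_mul_eq_sum]
    simp only [Matrix.of_apply, star_star, hVe, hinj]
  · ext ⟨p, q⟩ ⟨p', q'⟩
    have h : X (p, q) (p', q') = ∑ k, N (p, p') k * star (V (q, q') k) := by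
      change M (p, p') (q, q') = _
      rw [hM, Matrix.mul_apply]
      rfl
    have hsub : ∑ k, N (p, p') k * star (V (q, q') k) =
        ∑ k : K, N (p, p') k.1 * star (V (q, q') k.1) := by
      refine (Finset.sum_filter_of_ne (p := fun k => 0 < l k) fun k _ hk => ?_).symm.trans
        (Finset.sum_subtype _ (by simp) _)
      by_contra hlk
      exact hk (by rw [hzero k hlk, zero_mul])
    rw [h, hsub, ← e.sum_comp]
    simp only [Matrix.sum_apply, Matrix.smul_apply, Matrix.kroneckerMap_apply, Matrix.of_apply,
      smul_eq_mul]
    refine Finset.sum_congr rfl fun k _ => ?_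
    have := hne k
    field_simp

variable [DecidableEq P]

theorem commute_kronecker_one_of_mem_Comm {X : Matrix (P × Q) (P × Q) ℂ} {a : Matrix P P ℂ}
    (ha : a ∈ Comm (StarAlgebra.adjoin ℂ (schmidtLeft X))) :
    Commute (a ⊗ₖ (1 : Matrix Q Q ℂ)) X := by
  obtain ⟨n, s, A, B, h⟩ := exists_isOperatorSchmidt X
  rw [h.eq_sum]
  refine Commute.sum_right _ _ _ fun k _ => Commute.smul_right ?_ _
  have hk : a * A k = A k * a := ha _ (StarAlgebra.subset_adjoin ℂ _ ⟨n, s, A, B, h, k, rfl⟩)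
  rw [commute_iff_eq, ← Matrix.mul_kronecker_mul, ← Matrix.mul_kronecker_mul, hk, one_mul, mul_one]

theorem commute_one_kronecker_of_mem_Comm {X : Matrix (P × Q) (P × Q) ℂ} {b : Matrix Q Q ℂ}
    (hb : b ∈ Comm (StarAlgebra.adjoin ℂ (schmidtRight X))) :
    Commute ((1 : Matrix P P ℂ) ⊗ₖ b) X := by
  obtain ⟨n, s, A, B, h⟩ := exists_isOperatorSchmidt X
  rw [h.eq_sum]
  refine Commute.sum_right _ _ _ fun k _ => Commute.smul_right ?_ _
  have hk : b * B k = B k * b := hb _ (StarAlgebra.subset_adjoin ℂ _ ⟨n, s, A, B, h, k, rfl⟩)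
  rw [commute_iff_eq, ← Matrix.mul_kronecker_mul, ← Matrix.mul_kronecker_mul, hk, one_mul, mul_one]

omit [Fintype P] [DecidableEq P] [DecidableEq Q] in
/-- Contracting the second factor of `∑ₖ Zₖ ⊗ Bₖ`, for an orthonormal family `B`, with `Bⱼ`
recovers `Zⱼ`, so a vanishing sum has vanishing coefficients. -/
theorem eq_zero_of_sum_kronecker_eq_zero {n : ℕ} {Z : Fin n → Matrix P P ℂ}
    {B : Fin n → Matrix Q Q ℂ}
    (hB : ∀ j k, ((B j)ᴴ * B k).trace = if j = k then 1 else 0)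
    (h : ∑ k, Z k ⊗ₖ B k = 0) (j : Fin n) : Z j = 0 := by
  ext p p'
  have h1 : ∀ y : Q × Q, ∑ k, Z k p p' * B k y.1 y.2 = 0 := by
    intro y
    have := congrFun (congrFun h (p, y.1)) (p', y.2)
    simpa [Matrix.sum_apply, Matrix.kroneckerMap_apply] using this
  have h2 : ∑ y : Q × Q, star (B j y.1 y.2) * ∑ k, Z k p p' * B k y.1 y.2 = Z j p p' := by
    simp only [Finset.mul_sum]
    rw [Finset.sum_comm]
    have : ∀ k, ∑ y : Q × Q, star (B j y.1 y.2) * (Z k p p' * B k y.1 y.2) =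
        Z k p p' * if j = k then 1 else 0 := by
      intro k
      rw [← hB, trace_conjTranspose_mul_eq_sum, Finset.mul_sum]
      exact Finset.sum_congr rfl fun y _ => by ring
    simp only [this, mul_ite, mul_one, mul_zero, Finset.sum_ite_eq, Finset.mem_univ, if_true]
  rw [← h2]
  simp [h1]

theorem commute_of_mem_schmidtLeft {X : Matrix (P × Q) (P × Q) ℂ} {a c : Matrix P P ℂ}
    (h : Commute (a ⊗ₖ (1 : Matrix Q Q ℂ)) X) (hc : c ∈ schmidtLeft X) : Commute a c := by
  obtain ⟨n, s, A, B, hX, j, rfl⟩ := hc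
  have h0 : ∑ k, ((s k : ℂ) • (a * A k - A k * a)) ⊗ₖ B k = 0 := by
    have := sub_eq_zero.mpr h.eq
    rw [hX.eq_sum, Finset.mul_sum, Finset.sum_mul, ← Finset.sum_sub_distrib] at this
    rw [← this]
    refine Finset.sum_congr rfl fun k _ => ?_
    rw [mul_smul_comm, smul_mul_assoc, ← Matrix.mul_kronecker_mul, ← Matrix.mul_kronecker_mul,
      one_mul, mul_one, ← smul_sub, Matrix.smul_kronecker]
    congr 1
    ext ⟨p, q⟩ ⟨p', q'⟩
    simp [Matrix.kroneckerMap_apply, sub_mul]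
  have hj := eq_zero_of_sum_kronecker_eq_zero hX.orthonormal_right h0 j
  have hs : (s j : ℂ) ≠ 0 := by exact_mod_cast (hX.pos j).ne'
  exact sub_eq_zero.mp ((smul_eq_zero.mp hj).resolve_left hs)

theorem mem_Comm_schmidtLeft {X : Matrix (P × Q) (P × Q) ℂ} {a : Matrix P P ℂ}
    (hX : X ∈ Matrix.unitaryGroup (P × Q) ℂ) (h : Commute (a ⊗ₖ (1 : Matrix Q Q ℂ)) X) :
    a ∈ Comm (StarAlgebra.adjoin ℂ (schmidtLeft X)) := by
  have h' : Commute (aᴴ ⊗ₖ (1 : Matrix Q Q ℂ)) X := by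
    have := commute_star_of_mem_unitary hX h
    rwa [Matrix.star_eq_conjTranspose, Matrix.conjTranspose_kronecker,
      Matrix.conjTranspose_one] at this
  exact fun c hc => commute_of_mem_starAdjoin (fun _ hx => commute_of_mem_schmidtLeft h hx)
    (fun _ hx => commute_of_mem_schmidtLeft h' hx) hc

end Schmidt
/-! ### Operators on `C` commuting with a left-wall -/

section Tripartite

variable {L C R : Type*} [DecidableEq L] [DecidableEq R]

theorem star_onC (Q : Matrix C C ℂ) : star (onC L R Q) = onC L R (star Q) := by
  simp only [onC, Matrix.star_eq_conjTranspose, Matrix.conjTranspose_kronecker,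
    Matrix.conjTranspose_one]

theorem onC_injective [Nonempty L] [Nonempty R] :
    Function.Injective (onC L R : Matrix C C ℂ → _) := by
  intro Q Q' h
  obtain ⟨l⟩ := ‹Nonempty L›
  obtain ⟨r⟩ := ‹Nonempty R›
  ext c c'
  simpa [onC, Matrix.kroneckerMap_apply] using congrFun (congrFun h (l, c, r)) (l, c', r)

theorem onC_mul [Fintype L] [Fintype C] [Fintype R] (Q Q' : Matrix C C ℂ) :
    onC L R (Q * Q') = onC L R Q * onC L R Q' := by
  rw [onC, onC, onC, ← Matrix.mul_kronecker_mul, ← Matrix.mul_kronecker_mul, one_mul, one_mul]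

variable [Fintype L] [Fintype C] [DecidableEq C] [Fintype R]

theorem commute_onC_onL (Q : Matrix C C ℂ) (m : Matrix L L ℂ) :
    Commute (onC L R Q) (onL C R m) := by
  rw [commute_iff_eq, onC, onL, ← Matrix.mul_kronecker_mul, ← Matrix.mul_kronecker_mul, one_mul,
    one_mul, mul_one, mul_one]

theorem commute_onC_evolve {U : Matrix (L × C × R) (L × C × R) ℂ}
    (hU : U ∈ Matrix.unitaryGroup (L × C × R) ℂ) {Q : Matrix C C ℂ} (hQ : Commute (onC L R Q) U)
    (t : ℕ) (m : Matrix L L ℂ) : Commute (onC L R Q) (evolve U t (onL C R m)) := by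
  have h : Commute (onC L R Q) Uᴴ := by
    have := (commute_star_of_mem_unitary hU hQ).star_star
    rwa [star_star] at this
  exact ((hQ.pow_right t).mul_right (commute_onC_onL Q m)).mul_right (h.pow_right t)

/-- Commuting with `U` and, trivially, with `M_L`, a local conserved operator commutes with all of
`A_C`. -/
theorem commute_embeddedAlgebra [Nonempty L] [Nonempty R]
    {U : Matrix (L × C × R) (L × C × R) ℂ} (hU : U ∈ Matrix.unitaryGroup (L × C × R) ℂ)
    {Q a : Matrix C C ℂ} (hQ : Q ∈ localCommutant U) (ha : a ∈ embeddedAlgebra U) :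
    Commute Q a := by
  have hQ' : Commute (onC L R (star Q)) U := star_onC (L := L) (R := R) Q ▸
    commute_star_of_mem_unitary hU hQ
  have h : Commute (onC L R Q) (onC L R a) := by
    refine commute_of_mem_starAdjoin ?_ ?_ ha
    · rintro _ ⟨t, m, rfl⟩
      exact commute_onC_evolve hU hQ t m
    · rintro _ ⟨t, m, rfl⟩
      rw [star_onC]
      exact commute_onC_evolve hU hQ' t m
  exact onC_injective (L := L) (R := R) (by rw [onC_mul, onC_mul, h.eq])

end Tripartite

/-! ### Block decompositions -/

section Blocks

variable {L R ι : Type*} {D E : ι → Type*} [DecidableEq L] [DecidableEq R] [DecidableEq ι]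

/-- The operator `1_L ⊗ Y ⊗ 1_R` for `Y` on `P ⊗ Q`, with the factors grouped as
`(L ⊗ P) ⊗ (Q ⊗ R)`. -/
def extendBlock (L R : Type*) [DecidableEq L] [DecidableEq R] {P Q : Type*}
    (Y : Matrix (P × Q) (P × Q) ℂ) : Matrix ((L × P) × (Q × R)) ((L × P) × (Q × R)) ℂ :=
  Matrix.of fun x y => (1 : Matrix L L ℂ) x.1.1 y.1.1 *
    (Y (x.1.2, x.2.1) (y.1.2, y.2.1) * (1 : Matrix R R ℂ) x.2.2 y.2.2)

theorem extendBlock_kronecker {P Q : Type*} (a : Matrix P P ℂ) (b : Matrix Q Q ℂ) :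
    extendBlock L R (a ⊗ₖ b) = ((1 : Matrix L L ℂ) ⊗ₖ a) ⊗ₖ (b ⊗ₖ (1 : Matrix R R ℂ)) := by
  ext ⟨⟨l, p⟩, q, r⟩ ⟨⟨l', p'⟩, q', r'⟩
  simp only [extendBlock, Matrix.of_apply, Matrix.kroneckerMap_apply]
  ring

theorem onC_blockDiagonal' (Y : ∀ i, Matrix (D i × E i) (D i × E i) ℂ) :
    onC L R (Matrix.blockDiagonal' Y) =
      (Matrix.blockDiagonal' fun i => extendBlock L R (Y i)).submatrix
        (blockIndex L R D E) (blockIndex L R D E) := by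
  ext ⟨l, ⟨i, d, e⟩, r⟩ ⟨l', ⟨j, d', e'⟩, r'⟩
  by_cases hij : i = j
  · subst hij
    simp [onC, blockIndex, Matrix.kroneckerMap_apply, extendBlock]
  · simp [onC, blockIndex, Matrix.kroneckerMap_apply, Matrix.blockDiagonal'_apply_ne _ _ _ hij]

variable [Fintype L] [Fintype R] [Fintype ι] [∀ i, Fintype (D i)] [∀ i, DecidableEq (D i)]
  [∀ i, Fintype (E i)] [∀ i, DecidableEq (E i)]

theorem mul_blockDiagonal'_apply {F : ι → Type*} [∀ i, Fintype (F i)]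
    (Q : Matrix (Σ i, F i) (Σ i, F i) ℂ) (M : ∀ i, Matrix (F i) (F i) ℂ) (x : Σ i, F i) (i : ι)
    (y : F i) : (Q * Matrix.blockDiagonal' M) x ⟨i, y⟩ = ∑ z, Q x ⟨i, z⟩ * M i z y := by
  rw [Matrix.mul_apply, Fintype.sum_sigma, Finset.sum_eq_single i]
  · simp
  · intro j _ hj
    exact Finset.sum_eq_zero fun z _ => by rw [Matrix.blockDiagonal'_apply_ne _ _ _ hj, mul_zero]
  · simp

theorem blockDiagonal'_mul_apply {F : ι → Type*} [∀ i, Fintype (F i)]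
    (Q : Matrix (Σ i, F i) (Σ i, F i) ℂ) (M : ∀ i, Matrix (F i) (F i) ℂ) (x : Σ i, F i) (i : ι)
    (y : F i) : (Matrix.blockDiagonal' M * Q) ⟨i, y⟩ x = ∑ z, M i y z * Q ⟨i, z⟩ x := by
  rw [Matrix.mul_apply, Fintype.sum_sigma, Finset.sum_eq_single i]
  · simp
  · intro j _ hj
    exact Finset.sum_eq_zero fun z _ => by
      rw [Matrix.blockDiagonal'_apply_ne _ _ _ hj.symm, zero_mul]
  · simp

/-- The commutant of `⨁ᵢ M_{Dᵢ} ⊗ 1_{Eᵢ}` is contained in `⨁ᵢ 1_{Dᵢ} ⊗ M_{Eᵢ}`. -/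
theorem exists_eq_blockDiagonal'_one_kronecker
    {Q : Matrix (Σ i, D i × E i) (Σ i, D i × E i) ℂ}
    (hQ : ∀ m : ∀ i, Matrix (D i) (D i) ℂ,
      Commute Q (Matrix.blockDiagonal' fun i => m i ⊗ₖ (1 : Matrix (E i) (E i) ℂ))) :
    ∃ q : ∀ i, Matrix (E i) (E i) ℂ,
      Q = Matrix.blockDiagonal' fun i => (1 : Matrix (D i) (D i) ℂ) ⊗ₖ q i := by
  -- the commutation relation with the matrix unit `|d⟩⟨d'|` in block `i`, entry by entry
  have key : ∀ i (d d' : D i) j (x' : D j) (y : E i) (y' : E j),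
      ∑ z : D j × E j, Q ⟨i, (d, y)⟩ ⟨j, z⟩ *
        ((Pi.single i (Matrix.single d d' 1) : ∀ i, Matrix (D i) (D i) ℂ) j ⊗ₖ
          (1 : Matrix (E j) (E j) ℂ)) z (x', y') = Q ⟨i, (d', y)⟩ ⟨j, (x', y')⟩ := by
    intro i d d' j x' y y'
    have h := congrFun (congrFun (hQ (Pi.single i (Matrix.single d d' 1))).eq
      ⟨i, (d, y)⟩) ⟨j, (x', y')⟩
    rw [mul_blockDiagonal'_apply, blockDiagonal'_mul_apply] at h
    rw [h]
    simp [Fintype.sum_prod_type, Matrix.kroneckerMap_apply, Matrix.single_apply,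
      Matrix.one_apply]
  -- `d = d'` against another block: the off-diagonal blocks vanish
  have hoff : ∀ i j, i ≠ j → ∀ x y, Q ⟨i, x⟩ ⟨j, y⟩ = 0 := by
    rintro i j hij ⟨d, y⟩ ⟨x', y'⟩
    rw [← key i d d j x' y y', Pi.single_eq_of_ne hij.symm]
    simp
  -- within a block, moving `d'` to `d`: the block is `1 ⊗ q` with `q` read off at any `d`
  have hdiag : ∀ i (d d' x' : D i) (y y' : E i), Q ⟨i, (d', y)⟩ ⟨i, (x', y')⟩ =
      if d' = x' then Q ⟨i, (d, y)⟩ ⟨i, (d, y')⟩ else 0 := by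
    intro i d d' x' y y'
    rw [← key i d d' i x' y y', Pi.single_eq_same]
    simp [Fintype.sum_prod_type, Matrix.kroneckerMap_apply, Matrix.single_apply,
      Matrix.one_apply, ite_and]
  classical
  refine ⟨fun i => if h : Nonempty (D i) then
    Matrix.of fun y y' => Q ⟨i, (h.some, y)⟩ ⟨i, (h.some, y')⟩ else 0, ?_⟩
  ext ⟨i, d, y⟩ ⟨j, x', y'⟩
  by_cases hij : i = j
  · subst hij
    have hne : Nonempty (D i) := ⟨d⟩
    rw [Matrix.blockDiagonal'_apply_eq, Matrix.kroneckerMap_apply, Matrix.one_apply,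
      hdiag i hne.some]
    simp [dif_pos hne]
  · rw [hoff i j hij, Matrix.blockDiagonal'_apply_ne _ _ _ hij]

omit [∀ i, DecidableEq (D i)] [∀ i, DecidableEq (E i)] in
theorem commute_onC_blockDiagonal'_wallSum_iff {Y : ∀ i, Matrix (D i × E i) (D i × E i) ℂ}
    {T : ∀ i, Matrix (L × D i) (L × D i) ℂ} {S : ∀ i, Matrix (E i × R) (E i × R) ℂ} :
    Commute (onC L R (Matrix.blockDiagonal' Y)) (wallSum T S) ↔
      ∀ i, Commute (extendBlock L R (Y i)) (T i ⊗ₖ S i) := by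
  simp only [commute_iff_eq]
  rw [onC_blockDiagonal', wallSum, Matrix.submatrix_mul_equiv, Matrix.submatrix_mul_equiv,
    ← Matrix.blockDiagonal'_mul, ← Matrix.blockDiagonal'_mul,
    ← Matrix.blockDiagonal'_injective.eq_iff.trans funext_iff]
  refine ⟨fun h => ?_, fun h => by rw [h]⟩
  have h' := congrArg
    (Matrix.submatrix · (blockIndex L R D E).symm (blockIndex L R D E).symm) h
  simpa only [Matrix.submatrix_submatrix, Equiv.self_comp_symm, Matrix.submatrix_id_id] using h'

theorem commute_extendBlock_of_mem_tensorSpan {P Q : Type*} [Fintype P] [DecidableEq P]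
    [Fintype Q] [DecidableEq Q] {T : Matrix (L × P) (L × P) ℂ} {S : Matrix (Q × R) (Q × R) ℂ}
    {Y : Matrix (P × Q) (P × Q) ℂ}
    (hY : Y ∈ tensorSpan (Comm (StarAlgebra.adjoin ℂ (schmidtRight T)))
      (Comm (StarAlgebra.adjoin ℂ (schmidtLeft S)))) :
    Commute (extendBlock L R Y) (T ⊗ₖ S) := by
  induction hY using Submodule.span_induction with
  | mem Y hY =>
    obtain ⟨a, ha, b, hb, rfl⟩ := hY
    rw [extendBlock_kronecker, commute_iff_eq, ← Matrix.mul_kronecker_mul,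
      ← Matrix.mul_kronecker_mul, (commute_one_kronecker_of_mem_Comm ha).eq,
      (commute_kronecker_one_of_mem_Comm hb).eq]
  | zero =>
    have : extendBlock L R (0 : Matrix (P × Q) (P × Q) ℂ) = 0 := by
      ext
      simp [extendBlock]
    exact this ▸ Commute.zero_left _
  | add Y Z _ _ hY hZ =>
    have : extendBlock L R (Y + Z) = extendBlock L R Y + extendBlock L R Z := by
      ext
      simp [extendBlock, mul_add, add_mul]
    exact this ▸ hY.add_left hZ
  | smul c Y _ hY =>
    have : extendBlock L R (c • Y) = c • extendBlock L R Y := by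
      ext
      simp only [extendBlock, Matrix.of_apply, Matrix.smul_apply, smul_eq_mul]
      ring
    exact this ▸ hY.smul_left c

theorem eq_zero_of_kronecker_eq_zero {P Q : Type*} [Fintype P] [DecidableEq P] [Nonempty P]
    {T : Matrix P P ℂ} (hT : T ∈ Matrix.unitaryGroup P ℂ) {Z : Matrix Q Q ℂ}
    (h : T ⊗ₖ Z = 0) : Z = 0 := by
  by_contra hZ
  have hT0 : T ≠ 0 := by
    rintro rfl
    have := Matrix.mem_unitaryGroup_iff.mp hT
    rw [zero_mul] at this
    exact zero_ne_one this
  obtain ⟨p, p', hp⟩ : ∃ p p', T p p' ≠ 0 := by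
    by_contra! h0
    exact hT0 (Matrix.ext h0)
  refine hZ (Matrix.ext fun q q' => ?_)
  have := congrFun (congrFun h (p, q)) (p', q')
  exact (mul_eq_zero.mp this).resolve_left hp

/-- The unitary `T` cancels from the commutation of `1 ⊗ q` with `T ⊗ S`, leaving a condition on `q`
and `S` alone; the factor `1` lies in every commutant. -/
theorem one_kronecker_mem_tensorSpan [Nonempty L] {P Q : Type*} [Fintype P] [DecidableEq P]
    [Fintype Q] [DecidableEq Q] {T : Matrix (L × P) (L × P) ℂ} {S : Matrix (Q × R) (Q × R) ℂ}
    (hT : T ∈ Matrix.unitaryGroup (L × P) ℂ) (hS : S ∈ Matrix.unitaryGroup (Q × R) ℂ)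
    {q : Matrix Q Q ℂ} (h : Commute (extendBlock L R ((1 : Matrix P P ℂ) ⊗ₖ q)) (T ⊗ₖ S)) :
    (1 : Matrix P P ℂ) ⊗ₖ q ∈ tensorSpan (Comm (StarAlgebra.adjoin ℂ (schmidtRight T)))
      (Comm (StarAlgebra.adjoin ℂ (schmidtLeft S))) := by
  -- for empty `P` there is no `T` to cancel, but every operator on `P ⊗ Q` vanishes
  rcases isEmpty_or_nonempty P with hP | hP
  · have : (1 : Matrix P P ℂ) ⊗ₖ q = 0 := Matrix.ext fun x => hP.elim x.1
    rw [this]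
    exact zero_mem _
  refine Submodule.subset_span
    ⟨1, fun a _ => Commute.one_left a, q, mem_Comm_schmidtLeft hS ?_, rfl⟩
  rw [extendBlock_kronecker, commute_iff_eq, ← Matrix.mul_kronecker_mul,
    ← Matrix.mul_kronecker_mul, Matrix.one_kronecker_one, one_mul, mul_one] at h
  refine sub_eq_zero.mp (eq_zero_of_kronecker_eq_zero hT ?_)
  ext ⟨x, y⟩ ⟨x', y'⟩
  have := congrFun (congrFun h (x, y)) (x', y')
  simp only [Matrix.kroneckerMap_apply] at this
  simp [Matrix.kroneckerMap_apply, mul_sub, this]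

end Blocks

/-! ### Changing the identification of `C` -/

section Conjugation

/-- Conjugation by an isometric identification `V` (so `Vᴴ V = 1`) preserves and reflects
commutation. -/
theorem commute_conj_iff {m n : Type*} [Fintype m] [Fintype n] [DecidableEq m] [DecidableEq n]
    {V : Matrix m n ℂ} (hV : Vᴴ * V = 1) {X Y : Matrix n n ℂ} :
    Commute (V * X * Vᴴ) (V * Y * Vᴴ) ↔ Commute X Y := by
  have hmul : ∀ X Y : Matrix n n ℂ, V * X * Vᴴ * (V * Y * Vᴴ) = V * (X * Y) * Vᴴ := by
    intro X Y
    simp only [Matrix.mul_assoc]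
    rw [← Matrix.mul_assoc Vᴴ V, hV, Matrix.one_mul]
  have hcancel : ∀ X : Matrix n n ℂ, Vᴴ * (V * X * Vᴴ) * V = X := by
    intro X
    simp only [Matrix.mul_assoc, hV, Matrix.mul_one]
    rw [← Matrix.mul_assoc, hV, Matrix.one_mul]
  rw [commute_iff_eq, commute_iff_eq, hmul, hmul]
  refine ⟨fun h => ?_, fun h => by rw [h]⟩
  rw [← hcancel (X * Y), h, hcancel]

variable {L C R ι : Type*} {D E : ι → Type*} [DecidableEq L] [DecidableEq R]

theorem conjTranspose_extendIso (W : Matrix C (Σ i, D i × E i) ℂ) :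
    (extendIso L R W)ᴴ = (1 : Matrix L L ℂ) ⊗ₖ (Wᴴ ⊗ₖ (1 : Matrix R R ℂ)) := by
  simp only [extendIso, Matrix.conjTranspose_kronecker, Matrix.conjTranspose_one]

variable [Fintype L] [Fintype R]

theorem extendIso_conjTranspose_mul_self [Fintype C] [DecidableEq ι]
    [∀ i, DecidableEq (D i)] [∀ i, DecidableEq (E i)] {W : Matrix C (Σ i, D i × E i) ℂ}
    (hW : Wᴴ * W = 1) :
    (extendIso L R W)ᴴ * extendIso L R W = 1 := by
  rw [conjTranspose_extendIso, extendIso, ← Matrix.mul_kronecker_mul, ← Matrix.mul_kronecker_mul,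
    hW, one_mul, one_mul, Matrix.one_kronecker_one, Matrix.one_kronecker_one]

theorem onC_conj [Fintype ι] [∀ i, Fintype (D i)] [∀ i, Fintype (E i)]
    (W : Matrix C (Σ i, D i × E i) ℂ)
    (Q : Matrix (Σ i, D i × E i) (Σ i, D i × E i) ℂ) :
    onC L R (W * Q * Wᴴ) = extendIso L R W * onC L R Q * (extendIso L R W)ᴴ := by
  rw [conjTranspose_extendIso, extendIso, onC, onC]
  simp only [← Matrix.mul_kronecker_mul, mul_one]

end Conjugation

end QuantumWall

theorem mainTheorem7 {L C R ι : Type*} {D E : ι → Type*}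
    [Fintype L] [DecidableEq L] [Nonempty L] [Fintype C] [DecidableEq C]
    [Fintype R] [DecidableEq R] [Nonempty R] [Fintype ι] [DecidableEq ι]
    [∀ i, Fintype (D i)] [∀ i, DecidableEq (D i)] [∀ i, Fintype (E i)] [∀ i, DecidableEq (E i)]
    (U : Matrix (L × C × R) (L × C × R) ℂ) (hU : QuantumWall.IsLeftWall U)
    (W : Matrix C (Σ i, D i × E i) ℂ) (hW : Wᴴ * W = 1) (hW' : W * Wᴴ = 1)
    (hA : QuantumWall.embeddedAlgebra U = QuantumWall.factorBlocks W)
    (T : ∀ i, Matrix (L × D i) (L × D i) ℂ) (hT : ∀ i, T i ∈ Matrix.unitaryGroup (L × D i) ℂ)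
    (S : ∀ i, Matrix (E i × R) (E i × R) ℂ) (hS : ∀ i, S i ∈ Matrix.unitaryGroup (E i × R) ℂ)
    (hUTS : U = QuantumWall.extendIso L R W * QuantumWall.wallSum T S *
      (QuantumWall.extendIso L R W)ᴴ) :
    QuantumWall.localCommutant U =
      QuantumWall.directSumBlocks W (fun i =>
        QuantumWall.tensorSpan
          (QuantumWall.Comm (StarAlgebra.adjoin ℂ (QuantumWall.schmidtRight (T i))))
          (QuantumWall.Comm (StarAlgebra.adjoin ℂ (QuantumWall.schmidtLeft (S i))))) := by
  have hcomm : ∀ Q', W * Q' * Wᴴ ∈ QuantumWall.localCommutant U ↔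
      Commute (QuantumWall.onC L R Q') (QuantumWall.wallSum T S) := by
    intro Q'
    rw [QuantumWall.localCommutant, Set.mem_ofPred_eq, QuantumWall.onC_conj, hUTS,
      QuantumWall.commute_conj_iff (QuantumWall.extendIso_conjTranspose_mul_self hW)]
  ext Q
  constructor
  · intro hQ
    have hQW : Q = W * (Wᴴ * Q * W) * Wᴴ := by
      simp only [Matrix.mul_assoc, hW', Matrix.mul_one]
      rw [← Matrix.mul_assoc, hW', Matrix.one_mul]
    obtain ⟨q, hq⟩ := QuantumWall.exists_eq_blockDiagonal'_one_kronecker (Q := Wᴴ * Q * W)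
      fun m => by
        rw [← QuantumWall.commute_conj_iff hW, ← hQW]
        exact QuantumWall.commute_embeddedAlgebra hU.1 hQ (hA ▸ ⟨m, rfl⟩)
    rw [hQW, hcomm, hq, QuantumWall.commute_onC_blockDiagonal'_wallSum_iff] at hQ
    exact ⟨_, fun i => QuantumWall.one_kronecker_mem_tensorSpan (hT i) (hS i) (hQ i), hq ▸ hQW⟩
  · rintro ⟨Y, hY, rfl⟩
    rw [hcomm, QuantumWall.commute_onC_blockDiagonal'_wallSum_iff]
    exact fun i => QuantumWall.commute_extendBlock_of_mem_tensorSpan (hY i)
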